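/- Let $n\ge 1$, let $\gamma=(\gamma_1,\dots,\gamma_n):\mathbb R\to\mathbb R^n$ be a (Lebesgue measurable) curve and let $K:\mathbb R\to\mathbb C$ be a kernel such that, for every $\varepsilon>0$, $$\int_{\varepsilon<|t|<1/\varepsilon}|K(t)|\,dt<\infty .$$ Suppose that there is $1\le j\le n$ such that $\|\gamma_j\|_{L^\infty(\mathbb R)}<\infty$ and $\mathrm{p.v.}\int_{\mathbb R}\gamma_j(t)K(t)\,dt=\infty$, meaning that $$\lim_{\varepsilon\to0^+}\Big|\int_{\varepsilon<|t|<1/\varepsilon}\gamma_j(t)K(t)\,dt\Big|=\infty .$$ For $\varepsilon>0$ and $f\in L^2(\mathbb R^n)$ put $$K_{\gamma,\varepsilon}f(x)=\int_{\varepsilon<|t|<1/\varepsilon}f(x-\gamma(t))K(t)\,dt,\qquad M_\gamma f(x)=\sup_{\varepsilon>0}|K_{\gamma,\varepsilon}f(x)| .$$ Each $K_{\gamma,\varepsilon}$ is a well-defined bounded operator on $L^2(\mathbb R^n)$ (for $f\in L^2(\mathbb R^n)$, the integral converges absolutely for almost every $x$). However, the family $(K_{\gamma,\varepsilon})_{\varepsilon>0}$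 is not uniformly bounded on $L^2(\mathbb R^n)$: there is no constant $C<\infty$ with $\|K_{\gamma,\varepsilon}f\|_{L^2}\le C\|f\|_{L^2}$ for all $\varepsilon>0$ and all $f\in L^2(\mathbb R^n)$. Consequently the maximal operator $M_\gamma$ is unbounded on $L^2(\mathbb R^n)$: there is no constant $C<\infty$ with $\|M_\gamma f\|_{L^2}\le C\|f\|_{L^2}$ for all $f\in L^2(\mathbb R^n)$. -/

import Mathlib

open MeasureTheory Filter Topology
open scoped ENNReal NNReal

/-- The symmetric truncation region `{t : ε < |t| < 1/ε}` on the real line. -/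
def truncRegion (ε : ℝ) : Set ℝ := {t : ℝ | ε < |t| ∧ |t| < 1 / ε}

/-- `p.v. ∫ g(t) dt = ∞`: the integrals of `g` over `ε < |t| < 1/ε` tend to infinity as `ε → 0⁺`.
Here `g` is complex valued and `∞` is the point at infinity of `ℂ`; for real `g` this covers
divergence to `+∞` as well as to `-∞`. -/
def PVIntegralEqInfty (g : ℝ → ℂ) : Prop :=
  Tendsto (fun ε : ℝ => ∫ t in truncRegion ε, g t) (𝓝[>] (0 : ℝ)) (Bornology.cobounded ℂ)

/-- The truncated operator `K_{γ,ε} f (x) = ∫_{ε < |t| < 1/ε} f(x - γ(t)) K(t) dt`. -/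
noncomputable def curveOp {n : ℕ} (γ : ℝ → EuclideanSpace ℝ (Fin n)) (K : ℝ → ℂ) (ε : ℝ)
    (f : EuclideanSpace ℝ (Fin n) → ℂ) (x : EuclideanSpace ℝ (Fin n)) : ℂ :=
  ∫ t in truncRegion ε, f (x - γ t) * K t

/-- The maximal operator `M_γ f (x) = sup_{ε > 0} |K_{γ,ε} f (x)|`, with values in `[0, ∞]`. -/
noncomputable def curveMaximalOp {n : ℕ} (γ : ℝ → EuclideanSpace ℝ (Fin n)) (K : ℝ → ℂ)
    (f : EuclideanSpace ℝ (Fin n) → ℂ) (x : EuclideanSpace ℝ (Fin n)) : ℝ≥0∞ :=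
  ⨆ (ε : ℝ) (_ : 0 < ε), ‖curveOp γ K ε f x‖ₑ

/-- `‖T f‖_{L²} ≤ C ‖f‖_{L²}` for every `f ∈ L²(ℝⁿ)`. The operator `T` may take complex-valued
or `[0, ∞]`-valued functions as values. -/
def L2BoundedBy {n : ℕ} {F : Type*} [ENorm F] (C : ℝ≥0)
    (T : (EuclideanSpace ℝ (Fin n) → ℂ) → EuclideanSpace ℝ (Fin n) → F) : Prop :=
  ∀ f : EuclideanSpace ℝ (Fin n) → ℂ, MemLp f 2 volume →
    eLpNorm (T f) 2 volume ≤ (C : ℝ≥0∞) * eLpNorm f 2 volume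

/-! ### Superpositions of translates on `L²` -/

section Superposition

variable {α : Type*} [MeasurableSpace α] {ν : Measure α} [SFinite ν] {n : ℕ}
  {γ : α → EuclideanSpace ℝ (Fin n)} {K : α → ℂ} {f : EuclideanSpace ℝ (Fin n) → ℂ}

/-! Each truncation is a convolution operator with Fourier multiplier `m_ε(ξ) = ∫ e^{-2πi ξ·γ(t)}
K(t) dt` over the truncation region. A uniform `L²` bound `C` would give `|m_ε(ξ)| ≤ C`; only the
line `ξ = s e_j` is needed, and there testing on wide modulated Gaussians suffices
(`norm_multiplier_le`). Since `|γ_j| ≤ M` almost everywhere, pick `g ∈ L¹(ℝ)` whose Fourier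
transform is `x` on `[-M, M]`. Fubini then gives `∫ γ_j K = ∫ g(v) m_ε(v e_j) dv`, of size at most
`‖g‖₁ C` for every `ε` (`exists_norm_integral_mul_le_of_multiplier_le`). This contradicts the
divergence of the principal value. -/

theorem aestronglyMeasurable_comp_sub_curve (hγ : AEMeasurable γ ν)
    (hf : AEStronglyMeasurable f volume) :
    AEStronglyMeasurable (fun p : α × EuclideanSpace ℝ (Fin n) => f (p.2 - γ p.1))
      (ν.prod volume) := by
  have hmeas := hγ.measurable_mk
  -- The shear preserves the product measure, so null sets pull back to null sets and `f` need only
  -- be a.e. strongly measurable.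
  have hskew : MeasurePreserving (fun p : α × EuclideanSpace ℝ (Fin n) =>
      (id p.1, p.2 - hγ.mk γ p.1)) (ν.prod volume) (ν.prod volume) :=
    (MeasurePreserving.id ν).skew_product (g := fun t x => x - hγ.mk γ t)
      (measurable_snd.sub (hmeas.comp measurable_fst))
      (Eventually.of_forall fun t => (measurePreserving_sub_right volume (hγ.mk γ t)).map_eq)
  have hcomp : AEStronglyMeasurable
      (fun p : α × EuclideanSpace ℝ (Fin n) => f (p.2 - hγ.mk γ p.1)) (ν.prod volume) :=
    hf.comp_quasiMeasurePreserving
      (Measure.quasiMeasurePreserving_snd.comp hskew.quasiMeasurePreserving)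
  refine hcomp.congr ?_
  filter_upwards [Measure.quasiMeasurePreserving_fst.ae hγ.ae_eq_mk] with p hp
  rw [hp]

theorem aestronglyMeasurable_curve_integrand (hγ : AEMeasurable γ ν)
    (hK : AEStronglyMeasurable K ν) (hf : AEStronglyMeasurable f volume) :
    AEStronglyMeasurable (fun p : α × EuclideanSpace ℝ (Fin n) => f (p.2 - γ p.1) * K p.1)
      (ν.prod volume) :=
  (aestronglyMeasurable_comp_sub_curve hγ hf).mul hK.comp_fst

theorem sq_lintegral_mul_le {μ : Measure α} {u w : α → ℝ≥0∞} (hu : AEMeasurable u μ)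
    (hw : AEMeasurable w μ) :
    (∫⁻ t, u t * w t ∂μ) ^ 2 ≤ (∫⁻ t, w t ∂μ) * ∫⁻ t, u t ^ 2 * w t ∂μ := by
  have hhalf : ∀ a : ℝ≥0∞, a ^ (1 / 2 : ℝ) * a ^ (1 / 2 : ℝ) = a := fun a => by
    rw [← ENNReal.rpow_add_of_nonneg _ _ (by norm_num) (by norm_num)]; norm_num
  have hsq : ∀ a : ℝ≥0∞, (a ^ (1 / 2 : ℝ)) ^ 2 = a := fun a => by rw [sq, hhalf]
  have h := ENNReal.lintegral_mul_le_Lp_mul_Lq μ Real.HolderConjugate.two_two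
    (f := fun t => w t ^ (1 / 2 : ℝ)) (g := fun t => u t * w t ^ (1 / 2 : ℝ))
    (hw.pow_const _) (hu.mul (hw.pow_const _))
  have h1 : ∀ t, ((fun t => w t ^ (1 / 2 : ℝ)) * fun t => u t * w t ^ (1 / 2 : ℝ)) t
      = u t * w t := fun t => by
    simp only [Pi.mul_apply]
    rw [mul_left_comm, hhalf]
  simp only [h1, ENNReal.rpow_two, mul_pow, hsq] at h
  calc (∫⁻ t, u t * w t ∂μ) ^ 2
      ≤ ((∫⁻ t, w t ∂μ) ^ (1 / 2 : ℝ) * (∫⁻ t, u t ^ 2 * w t ∂μ) ^ (1 / 2 : ℝ)) ^ 2 := by gcongr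
    _ = _ := by rw [mul_pow, hsq, hsq]

/-- Cauchy–Schwarz for the weight `|K| dν`, then Tonelli and translation invariance; this stands in
for Minkowski's integral inequality. -/
theorem lintegral_sq_lintegral_curve_le (hγ : AEMeasurable γ ν)
    (hK : AEStronglyMeasurable K ν) (hf : AEStronglyMeasurable f volume) :
    ∫⁻ x, (∫⁻ t, ‖f (x - γ t) * K t‖ₑ ∂ν) ^ 2
      ≤ (∫⁻ t, ‖K t‖ₑ ∂ν) ^ 2 * ∫⁻ x, ‖f x‖ₑ ^ 2 := by
  have hF := aestronglyMeasurable_comp_sub_curve hγ hf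
  have hmeas : AEMeasurable (fun p : α × EuclideanSpace ℝ (Fin n) =>
      ‖f (p.2 - γ p.1)‖ₑ ^ 2 * ‖K p.1‖ₑ) (ν.prod volume) :=
    (hF.enorm.pow_const 2).mul hK.comp_fst.enorm
  have hslice : ∀ᵐ x : EuclideanSpace ℝ (Fin n),
      AEStronglyMeasurable (fun t => f (x - γ t)) ν := hF.prod_swap.prodMk_left
  calc ∫⁻ x, (∫⁻ t, ‖f (x - γ t) * K t‖ₑ ∂ν) ^ 2
      ≤ ∫⁻ x, (∫⁻ t, ‖K t‖ₑ ∂ν) * ∫⁻ t, ‖f (x - γ t)‖ₑ ^ 2 * ‖K t‖ₑ ∂ν := by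
        refine lintegral_mono_ae ?_
        filter_upwards [hslice] with x hx
        simp only [enorm_mul]
        exact sq_lintegral_mul_le hx.enorm hK.enorm
    _ = (∫⁻ t, ‖K t‖ₑ ∂ν) * ∫⁻ x, ∫⁻ t, ‖f (x - γ t)‖ₑ ^ 2 * ‖K t‖ₑ ∂ν :=
        lintegral_const_mul'' _ hmeas.prod_swap.lintegral_prod_right'
    _ = (∫⁻ t, ‖K t‖ₑ ∂ν) * ∫⁻ t, (∫⁻ x, ‖f (x - γ t)‖ₑ ^ 2 * ‖K t‖ₑ) ∂ν := by
        rw [lintegral_lintegral_swap hmeas.prod_swap]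
    _ = (∫⁻ t, ‖K t‖ₑ ∂ν) * ∫⁻ t, (∫⁻ x, ‖f x‖ₑ ^ 2) * ‖K t‖ₑ ∂ν := by
        congr 1
        refine lintegral_congr fun t => ?_
        rw [lintegral_sub_right_eq_self (fun x => ‖f x‖ₑ ^ 2 * ‖K t‖ₑ) (γ t),
          lintegral_mul_const'' _ (hf.enorm.pow_const 2)]
    _ = _ := by
        rw [lintegral_const_mul'' _ hK.enorm]
        ring

theorem eLpNorm_two_eq_lintegral_sq {β F : Type*} [MeasurableSpace β] [ENorm F] {μ : Measure β}
    (g : β → F) : eLpNorm g 2 μ = (∫⁻ x, ‖g x‖ₑ ^ 2 ∂μ) ^ (1 / 2 : ℝ) := by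
  simp [eLpNorm_eq_lintegral_rpow_enorm_toReal]

theorem lintegral_enorm_sq_eq_eLpNorm_sq {β F : Type*} [MeasurableSpace β] [ENorm F]
    {μ : Measure β} (g : β → F) : ∫⁻ x, ‖g x‖ₑ ^ 2 ∂μ = eLpNorm g 2 μ ^ 2 := by
  rw [eLpNorm_two_eq_lintegral_sq, ← ENNReal.rpow_two, ← ENNReal.rpow_mul]
  norm_num

theorem eLpNorm_curve_integral_le (hγ : AEMeasurable γ ν)
    (hK : AEStronglyMeasurable K ν) (hf : AEStronglyMeasurable f volume) :
    eLpNorm (fun x => ∫ t, f (x - γ t) * K t ∂ν) 2 volume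
      ≤ (∫⁻ t, ‖K t‖ₑ ∂ν) * eLpNorm f 2 volume := by
  rw [← ENNReal.pow_le_pow_left_iff two_ne_zero, mul_pow, ← lintegral_enorm_sq_eq_eLpNorm_sq,
    ← lintegral_enorm_sq_eq_eLpNorm_sq]
  refine le_trans (lintegral_mono fun x => ?_) (lintegral_sq_lintegral_curve_le hγ hK hf)
  gcongr
  exact enorm_integral_le_lintegral_enorm _

theorem ae_integrable_curve_integrand (hγ : AEMeasurable γ ν) (hK : Integrable K ν)
    (hf : MemLp f 2 volume) :
    ∀ᵐ x, Integrable (fun t => f (x - γ t) * K t) ν := by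
  have hm := aestronglyMeasurable_curve_integrand hγ hK.1 hf.1
  have hlt : ∫⁻ x, (∫⁻ t, ‖f (x - γ t) * K t‖ₑ ∂ν) ^ 2 < ∞ := by
    refine (lintegral_sq_lintegral_curve_le hγ hK.1 hf.1).trans_lt ?_
    rw [lintegral_enorm_sq_eq_eLpNorm_sq]
    exact ENNReal.mul_lt_top (ENNReal.pow_lt_top hK.2) (ENNReal.pow_lt_top hf.2)
  filter_upwards [hm.prod_swap.prodMk_left,
    ae_lt_top' (hm.prod_swap.enorm.lintegral_prod_right'.pow_const 2) hlt.ne] with x h1 h2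
  refine ⟨h1, ?_⟩
  simpa [HasFiniteIntegral] using h2

theorem memLp_curve_integral (hγ : AEMeasurable γ ν) (hK : Integrable K ν)
    (hf : MemLp f 2 volume) :
    MemLp (fun x => ∫ t, f (x - γ t) * K t ∂ν) 2 volume :=
  ⟨(aestronglyMeasurable_curve_integrand hγ hK.1 hf.1).prod_swap.integral_prod_right',
    (eLpNorm_curve_integral_le hγ hK.1 hf.1).trans_lt (ENNReal.mul_lt_top hK.2 hf.2)⟩

end Superposition

/-! ### Modulated Gaussians -/

section WavePacket

open Real FourierTransform

variable {n : ℕ}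

/-- The modulated Gaussian `x ↦ e^{2πi s x_j} e^{-a|x|²}`. -/
noncomputable def wavePacket (j : Fin n) (s a : ℝ) (x : EuclideanSpace ℝ (Fin n)) : ℂ :=
  ((𝐞 (s * x j) : Circle) : ℂ) * (rexp (-a * ‖x‖ ^ 2) : ℂ)

theorem continuous_wavePacket (j : Fin n) (s a : ℝ) : Continuous (wavePacket j s a) := by
  unfold wavePacket
  have h : Continuous fun x : EuclideanSpace ℝ (Fin n) => 𝐞 (s * x j) :=
    Real.continuous_fourierChar.comp (by fun_prop)
  fun_prop

theorem norm_wavePacket (j : Fin n) (s a : ℝ) (x : EuclideanSpace ℝ (Fin n)) :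
    ‖wavePacket j s a x‖ = rexp (-a * ‖x‖ ^ 2) := by
  simp only [wavePacket, norm_mul, Circle.norm_coe, one_mul, Complex.norm_real, Real.norm_eq_abs,
    abs_exp]

theorem integrable_rexp_neg_mul_sq_norm {b : ℝ} (hb : 0 < b) :
    Integrable (fun x : EuclideanSpace ℝ (Fin n) => rexp (-b * ‖x‖ ^ 2)) := by
  -- A non-integrable function has integral `0` by convention, but the Gaussian formula gives a
  -- positive value.
  by_contra h
  have h1 := GaussianFourier.integral_rexp_neg_mul_sq_norm
    (V := EuclideanSpace ℝ (Fin n)) hb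
  rw [integral_undef h] at h1
  have : 0 < (π / b) ^ (Module.finrank ℝ (EuclideanSpace ℝ (Fin n)) / 2 : ℝ) := by positivity
  linarith

theorem integral_rexp_neg_mul_sq_norm_pos {b : ℝ} (hb : 0 < b) :
    0 < ∫ x : EuclideanSpace ℝ (Fin n), rexp (-b * ‖x‖ ^ 2) := by
  rw [GaussianFourier.integral_rexp_neg_mul_sq_norm hb]
  positivity

theorem eLpNorm_wavePacket_sq (j : Fin n) (s : ℝ) {a : ℝ} (ha : 0 < a) :
    eLpNorm (wavePacket j s a) 2 volume ^ 2
      = ENNReal.ofReal (∫ x : EuclideanSpace ℝ (Fin n), rexp (-(2 * a) * ‖x‖ ^ 2)) := by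
  rw [← lintegral_enorm_sq_eq_eLpNorm_sq,
    ofReal_integral_eq_lintegral_ofReal (integrable_rexp_neg_mul_sq_norm (by positivity))
      (Eventually.of_forall fun x => (exp_pos _).le)]
  refine lintegral_congr fun x => ?_
  rw [← ofReal_norm, norm_wavePacket, ← ENNReal.ofReal_pow (exp_pos _).le, ← exp_nat_mul]
  congr 2
  push_cast
  ring

theorem memLp_wavePacket (j : Fin n) (s : ℝ) {a : ℝ} (ha : 0 < a) :
    MemLp (wavePacket j s a) 2 volume := by
  refine ⟨(continuous_wavePacket j s a).aestronglyMeasurable, ?_⟩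
  have h := eLpNorm_wavePacket_sq j s ha
  by_contra htop
  rw [not_lt, top_le_iff] at htop
  simp [htop] at h

theorem integrable_wavePacket (j : Fin n) (s : ℝ) {a : ℝ} (ha : 0 < a) :
    Integrable (wavePacket j s a) := by
  refine (integrable_rexp_neg_mul_sq_norm (n := n) ha).mono'
    (continuous_wavePacket j s a).aestronglyMeasurable (Eventually.of_forall fun x => ?_)
  rw [norm_wavePacket]

/-- Completing the square, `|x-y|² + |x|² = 2|x - y/2|² + |y|²/2`, while the modulations cancel up
to a character in `y`. -/
theorem wavePacket_sub_mul_conj (j : Fin n) (s a : ℝ) (x y : EuclideanSpace ℝ (Fin n)) :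
    wavePacket j s a (x - y) * (starRingEnd ℂ) (wavePacket j s a x)
      = ((𝐞 (-(s * y j)) : Circle) : ℂ) * (rexp (-(a / 2) * ‖y‖ ^ 2) : ℂ)
        * (rexp (-(2 * a) * ‖x - (1 / 2 : ℝ) • y‖ ^ 2) : ℂ) := by
  have hexp : rexp (-a * ‖x - y‖ ^ 2) * rexp (-a * ‖x‖ ^ 2)
      = rexp (-(a / 2) * ‖y‖ ^ 2) * rexp (-(2 * a) * ‖x - (1 / 2 : ℝ) • y‖ ^ 2) := by
    rw [← exp_add, ← exp_add, norm_sub_sq_real, norm_sub_sq_real, inner_smul_right, norm_smul]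
    congr 1
    norm_num
    ring
  have hchar : ((𝐞 (s * (x - y) j) : Circle) : ℂ) * (starRingEnd ℂ) ((𝐞 (s * x j) : Circle) : ℂ)
      = ((𝐞 (-(s * y j)) : Circle) : ℂ) := by
    have h : s * (x - y) j = -(s * y j) + s * x j := by
      simp only [PiLp.sub_apply]; ring
    rw [h, AddChar.map_add_eq_mul, Circle.coe_mul, mul_assoc, Complex.mul_conj,
      Circle.normSq_coe]
    simp
  have hexp' := congrArg (fun r : ℝ => (r : ℂ)) hexp
  simp only [Complex.ofReal_mul] at hexp'
  unfold wavePacket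
  rw [map_mul (starRingEnd ℂ), Complex.conj_ofReal, mul_mul_mul_comm, hchar, hexp', mul_assoc]

theorem integral_wavePacket_sub_mul_conj (j : Fin n) (s a : ℝ)
    (y : EuclideanSpace ℝ (Fin n)) :
    ∫ x, wavePacket j s a (x - y) * (starRingEnd ℂ) (wavePacket j s a x)
      = ((𝐞 (-(s * y j)) : Circle) : ℂ) * (rexp (-(a / 2) * ‖y‖ ^ 2) : ℂ)
        * ((∫ x : EuclideanSpace ℝ (Fin n), rexp (-(2 * a) * ‖x‖ ^ 2) : ℝ) : ℂ) := by
  simp_rw [wavePacket_sub_mul_conj, integral_const_mul]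
  rw [integral_sub_right_eq_self
    (fun x : EuclideanSpace ℝ (Fin n) => (rexp (-(2 * a) * ‖x‖ ^ 2) : ℂ))]
  congr 1
  exact integral_ofReal

end WavePacket

/-! ### Recovering the multiplier from the operator norm -/

section Multiplier

open Real FourierTransform

variable {α : Type*} [MeasurableSpace α] {ν : Measure α} [SFinite ν] {n : ℕ}
  {γ : α → EuclideanSpace ℝ (Fin n)} {K : α → ℂ}

theorem integral_curve_wavePacket_mul_conj (hγ : AEMeasurable γ ν) (hK : Integrable K ν)
    (j : Fin n) (s : ℝ) {a : ℝ} (ha : 0 < a) :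
    ∫ x, (∫ t, wavePacket j s a (x - γ t) * K t ∂ν) * (starRingEnd ℂ) (wavePacket j s a x)
      = ((∫ x : EuclideanSpace ℝ (Fin n), rexp (-(2 * a) * ‖x‖ ^ 2) : ℝ) : ℂ)
        * ∫ t, ((𝐞 (-(s * γ t j)) : Circle) : ℂ) * (rexp (-(a / 2) * ‖γ t‖ ^ 2) : ℂ) * K t ∂ν := by
  have hcont := continuous_wavePacket j s a
  have hint : Integrable (fun p : EuclideanSpace ℝ (Fin n) × α =>
      wavePacket j s a (p.1 - γ p.2) * K p.2 * (starRingEnd ℂ) (wavePacket j s a p.1))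
      (volume.prod ν) := by
    -- The translated packet has modulus at most `1`; what remains is a product of integrable
    -- functions.
    have hprod := (integrable_wavePacket j s ha).mul_prod hK
    refine hprod.norm.mono' ?_ (Eventually.of_forall fun p => ?_)
    · exact (aestronglyMeasurable_curve_integrand hγ hK.1
        hcont.aestronglyMeasurable).prod_swap.mul
        ((Complex.continuous_conj.comp hcont).aestronglyMeasurable.comp_fst)
    · rw [norm_mul, norm_mul, RCLike.norm_conj, norm_mul, mul_comm ‖wavePacket j s a p.1‖]
      gcongr
      refine mul_le_of_le_one_left (norm_nonneg _) ?_
      rw [norm_wavePacket, exp_le_one_iff]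
      nlinarith [sq_nonneg ‖p.1 - γ p.2‖]
  calc ∫ x, (∫ t, wavePacket j s a (x - γ t) * K t ∂ν) * (starRingEnd ℂ) (wavePacket j s a x)
      = ∫ x, ∫ t, wavePacket j s a (x - γ t) * K t
          * (starRingEnd ℂ) (wavePacket j s a x) ∂ν := by
        simp_rw [integral_mul_const]
    _ = ∫ t, (∫ x, wavePacket j s a (x - γ t) * K t
          * (starRingEnd ℂ) (wavePacket j s a x)) ∂ν := integral_integral_swap hint
    _ = _ := by
        rw [← integral_const_mul]
        refine integral_congr_ae (Eventually.of_forall fun t => ?_)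
        simp only [mul_right_comm _ (K t)]
        rw [integral_mul_const, integral_wavePacket_sub_mul_conj]
        ring

theorem enorm_integral_mul_conj_le {β : Type*} [MeasurableSpace β] {μ : Measure β} {u v : β → ℂ}
    (hu : AEStronglyMeasurable u μ) (hv : AEStronglyMeasurable v μ) :
    ‖∫ x, u x * (starRingEnd ℂ) (v x) ∂μ‖ₑ ≤ eLpNorm u 2 μ * eLpNorm v 2 μ := by
  calc ‖∫ x, u x * (starRingEnd ℂ) (v x) ∂μ‖ₑ
      ≤ ∫⁻ x, ‖u x * (starRingEnd ℂ) (v x)‖ₑ ∂μ := enorm_integral_le_lintegral_enorm _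
    _ = ∫⁻ x, ((fun x => ‖u x‖ₑ) * fun x => ‖v x‖ₑ) x ∂μ := by
        refine lintegral_congr fun x => ?_
        simp [← ofReal_norm]
    _ ≤ _ := by
        refine (ENNReal.lintegral_mul_le_Lp_mul_Lq μ Real.HolderConjugate.two_two
          hu.enorm hv.enorm).trans_eq ?_
        simp only [eLpNorm_two_eq_lintegral_sq, ENNReal.rpow_two]

/-- The quadratic form at a packet is its squared norm times a Gaussian-damped multiplier. Dividing
by that norm bounds the damped multiplier by `C`, and `a → 0⁺` removes the damping. -/
theorem norm_multiplier_le (hγ : AEMeasurable γ ν) (hK : Integrable K ν) {C : ℝ≥0}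
    (hC : ∀ f : EuclideanSpace ℝ (Fin n) → ℂ, MemLp f 2 volume →
      eLpNorm (fun x => ∫ t, f (x - γ t) * K t ∂ν) 2 volume ≤ C * eLpNorm f 2 volume)
    (j : Fin n) (s : ℝ) :
    ‖∫ t, ((𝐞 (-(s * γ t j)) : Circle) : ℂ) * K t ∂ν‖ ≤ C := by
  have hchar : AEStronglyMeasurable (fun t => ((𝐞 (-(s * γ t j)) : Circle) : ℂ)) ν := by
    have hc : Continuous fun x : EuclideanSpace ℝ (Fin n) => ((𝐞 (-(s * x j)) : Circle) : ℂ) :=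
      continuous_subtype_val.comp (Real.continuous_fourierChar.comp (by fun_prop))
    exact (hc.measurable.comp_aemeasurable hγ).aestronglyMeasurable
  have hdamped : ∀ a : ℝ, 0 < a →
      ‖∫ t, ((𝐞 (-(s * γ t j)) : Circle) : ℂ) * (rexp (-(a / 2) * ‖γ t‖ ^ 2) : ℂ) * K t ∂ν‖ ≤ C := by
    intro a ha
    have hG := integral_rexp_neg_mul_sq_norm_pos (n := n) (b := 2 * a) (by positivity)
    have hmem := memLp_wavePacket j s ha
    have h := enorm_integral_mul_conj_le (memLp_curve_integral hγ hK hmem).1 hmem.1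
    have h2 := h.trans (mul_le_mul_left (hC _ hmem) _)
    rw [integral_curve_wavePacket_mul_conj hγ hK j s ha, mul_assoc, ← sq,
      eLpNorm_wavePacket_sq j s ha, ← ofReal_norm, norm_mul, Complex.norm_real,
      Real.norm_of_nonneg hG.le, ← ENNReal.ofReal_coe_nnreal, ← ENNReal.ofReal_mul C.coe_nonneg,
      ENNReal.ofReal_le_ofReal_iff (by positivity), mul_comm] at h2
    exact le_of_mul_le_mul_right h2 hG
  have hlim : Tendsto (fun a : ℝ =>
      ∫ t, ((𝐞 (-(s * γ t j)) : Circle) : ℂ) * (rexp (-(a / 2) * ‖γ t‖ ^ 2) : ℂ) * K t ∂ν)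
      (𝓝[>] 0) (𝓝 (∫ t, ((𝐞 (-(s * γ t j)) : Circle) : ℂ) * K t ∂ν)) := by
    refine tendsto_integral_filter_of_dominated_convergence (fun t => ‖K t‖)
      (Eventually.of_forall fun a => ?_) ?_ hK.norm (Eventually.of_forall fun t => ?_)
    · refine (hchar.mul ?_).mul hK.1
      have hc : Continuous fun x : EuclideanSpace ℝ (Fin n) =>
        (rexp (-(a / 2) * ‖x‖ ^ 2) : ℂ) := by fun_prop
      exact (hc.measurable.comp_aemeasurable hγ).aestronglyMeasurable
    · filter_upwards [self_mem_nhdsWithin] with a ha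
      refine Eventually.of_forall fun t => ?_
      rw [norm_mul, norm_mul, Circle.norm_coe, one_mul, Complex.norm_real, Real.norm_eq_abs,
        abs_exp]
      refine mul_le_of_le_one_left (norm_nonneg _) ?_
      rw [exp_le_one_iff]
      have ha' : 0 < a := ha
      nlinarith [sq_nonneg ‖γ t‖]
    · have hc : Continuous fun a : ℝ =>
        ((𝐞 (-(s * γ t j)) : Circle) : ℂ) * (rexp (-(a / 2) * ‖γ t‖ ^ 2) : ℂ) * K t := by fun_prop
      have := hc.tendsto 0
      simp only [zero_div, neg_zero, zero_mul, exp_zero, Complex.ofReal_one, mul_one] at this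
      exact this.mono_left nhdsWithin_le_nhds
  refine le_of_tendsto hlim.norm ?_
  filter_upwards [self_mem_nhdsWithin] with a ha using hdamped a ha

end Multiplier

/-! ### From multiplier bounds to the integral of `φ K` -/

section Bernstein

open Real FourierTransform

theorem exists_integrable_fourier_eq_id_on_Icc (M : ℝ) :
    ∃ g : ℝ → ℂ, Integrable g ∧ ∀ x : ℝ, |x| ≤ M → ∫ v, ((𝐞 (-(v * x)) : Circle) : ℂ) * g v = x := by
  -- `b x * x` is Schwartz and equals `x` on `[-M, M]`; `g` is its inverse Fourier transform. Using
  -- `|M|` keeps the radii positive for any `M`.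
  let b : ContDiffBump (0 : ℝ) := ⟨|M| + 1, |M| + 2, by positivity, by linarith⟩
  have hsmooth : ContDiff ℝ (⊤ : ℕ∞) fun x : ℝ => ((b x * x : ℝ) : ℂ) :=
    Complex.ofRealCLM.contDiff.comp (b.contDiff.mul contDiff_id)
  have hsupp : HasCompactSupport fun x : ℝ => ((b x * x : ℝ) : ℂ) :=
    (b.hasCompactSupport.mul_right (f' := fun x : ℝ => x)).comp_left
      (g := fun r : ℝ => (r : ℂ)) Complex.ofReal_zero
  let h : SchwartzMap ℝ ℂ := hsupp.toSchwartzMap hsmooth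
  refine ⟨(𝓕⁻ h : SchwartzMap ℝ ℂ), (𝓕⁻ h : SchwartzMap ℝ ℂ).integrable, fun x hx => ?_⟩
  have h1 : (𝓕 (𝓕⁻ h : SchwartzMap ℝ ℂ) : SchwartzMap ℝ ℂ) x = h x := by
    rw [FourierTransform.fourier_fourierInv_eq]
  rw [SchwartzMap.fourier_coe, Real.fourier_real_eq] at h1
  have hb : b x = 1 := b.one_of_mem_closedBall (by
    rw [mem_closedBall_zero_iff, Real.norm_eq_abs]
    have := le_abs_self M
    change |x| ≤ |M| + 1
    linarith)
  have h2 : h x = x := by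
    change ((b x * x : ℝ) : ℂ) = x
    rw [hb, one_mul]
  rw [← h2, ← h1]
  rfl

/-- Here `B = ‖g‖₁` depends on `M` alone, so one constant serves all truncations. -/
theorem exists_norm_integral_mul_le_of_multiplier_le (M : ℝ) :
    ∃ B : ℝ, ∀ {α : Type} [MeasurableSpace α] {ν : Measure α} [SFinite ν] {φ : α → ℝ}
      {K : α → ℂ} {C : ℝ}, AEMeasurable φ ν → (∀ᵐ t ∂ν, |φ t| ≤ M) → Integrable K ν →
      (∀ s : ℝ, ‖∫ t, ((𝐞 (-(s * φ t)) : Circle) : ℂ) * K t ∂ν‖ ≤ C) →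
      ‖∫ t, (φ t : ℂ) * K t ∂ν‖ ≤ B * C := by
  obtain ⟨g, hg, hgM⟩ := exists_integrable_fourier_eq_id_on_Icc M
  refine ⟨∫ v, ‖g v‖, fun {α} _ ν _ φ K C hφ hM hK hC => ?_⟩
  have hint : Integrable (fun p : ℝ × α => g p.1 * (((𝐞 (-(p.1 * φ p.2)) : Circle) : ℂ) * K p.2))
      (volume.prod ν) := by
    have hprod := hg.mul_prod hK
    refine hprod.norm.mono' ?_ (Eventually.of_forall fun p => ?_)
    · have hc : Continuous fun r : ℝ => ((𝐞 r : Circle) : ℂ) :=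
        continuous_subtype_val.comp Real.continuous_fourierChar
      have hm : AEMeasurable (fun p : ℝ × α => -(p.1 * φ p.2)) (volume.prod ν) :=
        (measurable_fst.aemeasurable.mul hφ.comp_snd).neg
      exact hg.1.comp_fst.mul
        ((hc.measurable.comp_aemeasurable hm).aestronglyMeasurable.mul hK.1.comp_snd)
    · rw [norm_mul, norm_mul, norm_mul, Circle.norm_coe, one_mul]
  have hswap : ∫ t, (φ t : ℂ) * K t ∂ν = ∫ v, g v * ∫ t, ((𝐞 (-(v * φ t)) : Circle) : ℂ) * K t ∂ν := by
    simp_rw [← integral_const_mul]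
    rw [integral_integral_swap hint]
    refine integral_congr_ae ?_
    filter_upwards [hM] with t ht
    rw [← hgM _ ht, ← integral_mul_const]
    refine integral_congr_ae (Eventually.of_forall fun v => ?_)
    simp only
    ring
  rw [hswap, ← integral_mul_const]
  refine norm_integral_le_of_norm_le (hg.norm.mul_const C) (Eventually.of_forall fun v => ?_)
  rw [norm_mul]
  exact mul_le_mul_of_nonneg_left (hC v) (norm_nonneg _)

end Bernstein

/-! ### Unboundedness of the truncations and the maximal operator -/

section CurveOperators

variable {n : ℕ} {γ : ℝ → EuclideanSpace ℝ (Fin n)} {K : ℝ → ℂ}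

theorem not_uniformly_L2BoundedBy_curveOp (hγ : AEMeasurable γ volume)
    (hK : ∀ ε : ℝ, 0 < ε → IntegrableOn K (truncRegion ε) volume)
    (j : Fin n) (hbdd : eLpNorm (fun t : ℝ => γ t j) ∞ volume < ∞)
    (hpv : PVIntegralEqInfty (fun t : ℝ => (γ t j : ℂ) * K t)) :
    ¬ ∃ C : ℝ≥0, ∀ ε : ℝ, 0 < ε → L2BoundedBy C (curveOp γ K ε) := by
  rintro ⟨C, hC⟩
  have hM : ∀ᵐ t : ℝ, |γ t j| ≤ (eLpNorm (fun t : ℝ => γ t j) ∞ volume).toReal := by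
    have h := ae_le_eLpNormEssSup (f := fun t : ℝ => γ t j) (μ := volume)
    rw [← eLpNorm_exponent_top] at h
    filter_upwards [h] with t ht
    simpa using ENNReal.toReal_mono hbdd.ne ht
  obtain ⟨B, hB⟩ := exists_norm_integral_mul_le_of_multiplier_le
    (eLpNorm (fun t : ℝ => γ t j) ∞ volume).toReal
  have hφ : AEMeasurable (fun t => γ t j) volume :=
    (show Continuous fun x : EuclideanSpace ℝ (Fin n) => x j by
      fun_prop).measurable.comp_aemeasurable hγ
  have hbound : ∀ ε : ℝ, 0 < ε → ‖∫ t in truncRegion ε, (γ t j : ℂ) * K t‖ ≤ B * C :=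
    fun ε hε => hB hφ.restrict (ae_restrict_of_ae hM) (hK ε hε)
      (norm_multiplier_le hγ.restrict (hK ε hε) (hC ε hε) j)
  have htop : Tendsto (fun ε : ℝ => ‖∫ t in truncRegion ε, (γ t j : ℂ) * K t‖)
      (𝓝[>] (0 : ℝ)) atTop := tendsto_norm_cobounded_atTop.comp hpv
  obtain ⟨ε, hlt, hε⟩ :=
    ((htop.eventually_gt_atTop (B * C)).and self_mem_nhdsWithin).exists
  exact absurd (hbound ε hε) (not_le.mpr hlt)

theorem L2BoundedBy_curveOp_of_curveMaximalOp {C : ℝ≥0}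
    (hC : L2BoundedBy C (curveMaximalOp γ K)) {ε : ℝ} (hε : 0 < ε) :
    L2BoundedBy C (curveOp γ K ε) := fun f hf =>
  (eLpNorm_mono_enorm fun x => by
    rw [enorm_eq_self]
    exact le_iSup₂ (f := fun (ε : ℝ) (_ : 0 < ε) => ‖curveOp γ K ε f x‖ₑ) ε hε).trans (hC f hf)

end CurveOperators

theorem mainTheorem6 {n : ℕ} (γ : ℝ → EuclideanSpace ℝ (Fin n)) (hγ : AEMeasurable γ volume)
    (K : ℝ → ℂ) (hK : ∀ ε : ℝ, 0 < ε → IntegrableOn K (truncRegion ε) volume)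
    (j : Fin n) (hbdd : eLpNorm (fun t : ℝ => γ t j) ∞ volume < ∞)
    (hpv : PVIntegralEqInfty (fun t : ℝ => (γ t j : ℂ) * K t)) :
    -- each truncated operator is well defined and bounded on `L²`
    (∀ ε : ℝ, 0 < ε →
      (∀ f : EuclideanSpace ℝ (Fin n) → ℂ, MemLp f 2 volume →
        (∀ᵐ x ∂volume, IntegrableOn (fun t : ℝ => f (x - γ t) * K t) (truncRegion ε) volume) ∧
        MemLp (curveOp γ K ε f) 2 volume) ∧
      ∃ C : ℝ≥0, L2BoundedBy C (curveOp γ K ε)) ∧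
    -- the family is not uniformly bounded on `L²`
    (¬ ∃ C : ℝ≥0, ∀ ε : ℝ, 0 < ε → L2BoundedBy C (curveOp γ K ε)) ∧
    -- the maximal operator is unbounded on `L²`
    (¬ ∃ C : ℝ≥0, L2BoundedBy C (curveMaximalOp γ K)) := by
  have hnot := not_uniformly_L2BoundedBy_curveOp hγ hK j hbdd hpv
  refine ⟨fun ε hε => ⟨fun f hf => ⟨ae_integrable_curve_integrand hγ.restrict (hK ε hε) hf,
    memLp_curve_integral hγ.restrict (hK ε hε) hf⟩,
    (∫⁻ t in truncRegion ε, ‖K t‖ₑ).toNNReal, fun f hf => ?_⟩, hnot,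
    fun ⟨C, hC⟩ => hnot ⟨C, fun ε hε => L2BoundedBy_curveOp_of_curveMaximalOp hC hε⟩⟩
  rw [ENNReal.coe_toNNReal (hK ε hε).2.ne]
  exact eLpNorm_curve_integral_le hγ.restrict (hK ε hε).1 hf.1
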